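/- \textbf{Setting.} Fix $p\in\mathbb N$ and $\beta^*\in\mathbb R^p$; let $S=\{j:\beta^*_j\neq 0\}$ and $S^c=\{j:\beta^*_j=0\}$. For each sample size $n$ let $X=X_n\in\mathbb R^{n\times p}$ be a deterministic design matrix with rows $x_1,\dots,x_n$, and let $y=X\beta^*+\varepsilon$, where the entries $\varepsilon_1,\dots,\varepsilon_n$ of the noise are i.i.d. $\mathcal N(0,\sigma^2)$. Assume that, as $n\to\infty$, $\frac1n X^\top X\to C$ with $C$ positive definite and $\frac1n\max_i\|x_i\|_2^2\to 0$. Let $m=m_n$ be positive integers with $n/m\to r_0\ge 0$, and let $\tilde\beta$ (depending on $n$) be a random initial estimator, independent of $\varepsilon$, such that $\sqrt m(\tilde\beta-\beta^*)$ converges in distribution to a random vector $z$ (in particular $\tilde\beta$ is $\sqrt m$-consistent). For $\lambda_n,\eta_n\ge 0$ let the Transfer Lasso estimator $\hat\beta_n$ be a (measurable) minimizer over $\beta\in\mathbb R^p$ of $$\frac1n\|y-X\beta\|_2^2+\frac{\lambda_n}{n}\sum_{j=1}^p|\beta_j|+\frac{\eta_n}{n}\sum_{j=1}^p|\beta_j-\tilde\beta_j|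 .$$ Let $W\sim\mathcal N(0,\sigma^2C)$ be independent of $z$. \textbf{Theorem (Asymptotic distribution for the Transfer Lasso).} As $n\to\infty$: (i) If $\eta_n/\sqrt n\to\infty$ and $\lambda_n/\eta_n\to\rho_0$ with $0\le\rho_0<1$, then $\sqrt m(\hat\beta_n-\beta^*)\overset{d}{\to}z$. (ii) If $\lambda_n/\sqrt n\to\lambda_0\ge0$ and $\eta_n/\sqrt n\to\eta_0\ge0$, then $$\sqrt n(\hat\beta_n-\beta^*)\overset{d}{\to}\operatorname*{argmin}_{u\in\mathbb R^p}\Big\{u^\top Cu-2u^\top W+\lambda_0\Big(\sum_{j\in S}u_j\,\mathrm{sgn}(\beta^*_j)+\sum_{j\in S^c}|u_j|\Big)+\eta_0\sum_{j=1}^p|u_j-\sqrt{r_0}\,z_j|\Big\}.$$ (iii) If $\lambda_n/\sqrt n\to\infty$, $\lambda_n/n\to0$ and $\eta_n/\lambda_n\to\rho_0'\ge0$, then $$\frac{n}{\lambda_n}(\hat\beta_n-\beta^*)\overset{d}{\to}\operatorname*{argmin}_{u\in\mathbb R^p}\Big\{u^\top Cu+\sum_{j\in S}\big(u_j\,\mathrm{sgn}(\beta^*_j)+\rho_0'|u_j|\big)+\sum_{j\in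 S^c}(1+\rho_0')|u_j|\Big\}.$$ In (ii) (for every realization of $W$ and $z$) and in (iii) the minimizer exists and is unique. -/

import Mathlib

open MeasureTheory ProbabilityTheory Filter Topology

/-- The set of global minimizers of a real-valued function. -/
def argminSet {α : Type*} (f : α → ℝ) : Set α :=
  {x | ∀ y, f x ≤ f y}

/-- The response vector `y = X β + ε` of the linear model. -/
noncomputable def linearResponse {n p : ℕ} (X : Matrix (Fin n) (Fin p) ℝ)
    (β : EuclideanSpace ℝ (Fin p)) (ε : Fin n → ℝ) : Fin n → ℝ :=
  fun i => (∑ j, X i j * β j) + ε i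

/-- The Transfer Lasso objective
`(1/n) ‖y - X β‖₂² + (lam/n) ∑ⱼ |βⱼ| + (eta/n) ∑ⱼ |βⱼ - βinitⱼ|` as a function of `β`. -/
noncomputable def transferLassoObjective {n p : ℕ} (X : Matrix (Fin n) (Fin p) ℝ)
    (y : Fin n → ℝ) (lam eta : ℝ) (βinit β : EuclideanSpace ℝ (Fin p)) : ℝ :=
  (1 / (n : ℝ)) * ∑ i, (y i - ∑ j, X i j * β j) ^ 2
    + (lam / n) * ∑ j, |β j| + (eta / n) * ∑ j, |β j - βinit j|

/-- The active set `S = {j : βⱼ ≠ 0}`. -/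
noncomputable def activeSet {p : ℕ} (β : EuclideanSpace ℝ (Fin p)) : Finset (Fin p) :=
  Finset.univ.filter fun j => β j ≠ 0

/-- The quadratic form `uᵀ C u`. -/
noncomputable def quadForm {p : ℕ} (C : Matrix (Fin p) (Fin p) ℝ)
    (u : EuclideanSpace ℝ (Fin p)) : ℝ :=
  ∑ i, ∑ j, u i * C i j * u j

/-- The limit criterion when both regularization parameters are of order `√n`; here `w` and `z`
are values of the Gaussian limit and of the limit of the rescaled initial estimator. -/
noncomputable def limitCriterionRootN {p : ℕ} (C : Matrix (Fin p) (Fin p) ℝ)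
    (βstar : EuclideanSpace ℝ (Fin p)) (lam0 eta0 r0 : ℝ)
    (w z u : EuclideanSpace ℝ (Fin p)) : ℝ :=
  quadForm C u - 2 * ∑ j, u j * w j
    + lam0 * ((∑ j ∈ activeSet βstar, u j * Real.sign (βstar j))
        + ∑ j ∈ (activeSet βstar)ᶜ, |u j|)
    + eta0 * ∑ j, |u j - Real.sqrt r0 * z j|

/-- The deterministic limit criterion when `√n ≪ lam ≪ n` and `eta / lam → rho`. -/
noncomputable def limitCriterionSlow {p : ℕ} (C : Matrix (Fin p) (Fin p) ℝ)
    (βstar : EuclideanSpace ℝ (Fin p)) (rho : ℝ) (u : EuclideanSpace ℝ (Fin p)) : ℝ :=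
  quadForm C u
    + (∑ j ∈ activeSet βstar, (u j * Real.sign (βstar j) + rho * |u j|))
    + ∑ j ∈ (activeSet βstar)ᶜ, (1 + rho) * |u j|

/-!
In the local coordinate `u = (b - β) / a`, the Transfer Lasso objective becomes a criterion which is
convex in `u` and jointly continuous in `u` and all its parameters: the Gram matrix, the step size
`a`, the rescaled penalty weights, the rescaled score and the rescaled error of the initial
estimator. Continuity includes `a = 0`, where the difference quotient of the `ℓ¹` penalty is its
directional derivative, so the limit criteria are members of the same family.

If a member of such a family has a unique minimizer, it exceeds its minimum on a small sphere around
the minimizer; nearby members do so too, and by convexity all their minimizers lie inside the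
sphere. Uniformly over compact sets of scores and errors, this replaces the parameters by their
limits; tightness and the continuous mapping theorem then give (ii) and (iii) from the joint limit
of the score and the error.

In (i), the transfer penalty dominates the Lasso penalty and the gradient of the loss at the initial
estimator, which is a kink of the transfer penalty. With probability tending to one the two
estimators therefore coincide.
-/

open scoped Matrix

local notation:max "𝔼" p:max => EuclideanSpace ℝ (Fin p)

section ConvexMinimization

variable {K G F : Type*} [TopologicalSpace K] [TopologicalSpace G] [NormedAddCommGroup F]
  [NormedSpace ℝ F]

lemma convexOn_univ_sum {ι V : Type*} [AddCommGroup V] [Module ℝ V] {f : ι → V → ℝ}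
    (s : Finset ι) (hf : ∀ i ∈ s, ConvexOn ℝ Set.univ (f i)) :
    ConvexOn ℝ Set.univ fun x => ∑ i ∈ s, f i x := by
  have hsum := Finset.sum_induction f (ConvexOn ℝ Set.univ) (fun _ _ => ConvexOn.add)
    (convexOn_const 0 convex_univ) hf
  simpa only [Finset.sum_apply] using hsum.congr fun x _ => Finset.sum_apply x s f

lemma exists_mem_segment_mem_sphere {v u : F} {r : ℝ} (hr : 0 ≤ r) (hu : r ≤ dist u v) :
    ∃ x ∈ segment ℝ v u, x ∈ Metric.sphere v r := by
  have hdist : ContinuousOn (fun x => dist x v) (segment ℝ v u) := by fun_prop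
  have hpre : IsPreconnected (segment ℝ v u) := (convex_segment v u).isPreconnected
  simpa only [Set.mem_image, Metric.mem_sphere] using
    hpre.intermediate_value (left_mem_segment ℝ v u) (right_mem_segment ℝ v u) hdist
      ⟨(dist_self v).trans_le hr, hu⟩

lemma eventually_argminSet_subset_ball [ProperSpace F] {Ψ : K → F → ℝ}
    (hΨ : Continuous (Function.uncurry Ψ)) {k₀ : K} {v : F} (hv : argminSet (Ψ k₀) = {v})
    {e : ℝ} (he : 0 < e) :
    ∀ᶠ k in 𝓝 k₀, ConvexOn ℝ Set.univ (Ψ k) → argminSet (Ψ k) ⊆ Metric.ball v e := by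
  have hv_min : v ∈ argminSet (Ψ k₀) := hv.ge rfl
  have lt_on_sphere : ∀ x ∈ Metric.sphere v e, Ψ k₀ v < Ψ k₀ x := fun x hx => by
    refine (hv_min x).lt_of_not_ge fun hle => Metric.ne_of_mem_sphere hx he.ne' ?_
    exact hv.le fun y => hle.trans (hv_min y)
  have eventually_lt : ∀ᶠ k in 𝓝 k₀, ∀ x ∈ Metric.sphere v e, Ψ k v < Ψ k x := by
    refine (isCompact_sphere v e).eventually_forall_of_forall_eventually fun x hx => ?_
    have hleft : Continuous fun q : K × F => Ψ q.1 v := hΨ.comp₂ continuous_fst continuous_const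
    exact (isOpen_lt hleft hΨ).mem_nhds (lt_on_sphere x hx)
  filter_upwards [eventually_lt] with k hk hconv u hu
  by_contra hfar
  obtain ⟨x, hx_segment, hx_sphere⟩ := exists_mem_segment_mem_sphere he.le (not_lt.1 hfar)
  have hmax := hconv.le_max_of_mem_segment trivial trivial hx_segment
  rw [max_eq_left (hu v)] at hmax
  exact (hk x hx_sphere).not_ge hmax

lemma continuous_of_argminSet_eq_singleton [ProperSpace F] {Ψ : K → F → ℝ}
    (hΨ : Continuous (Function.uncurry Ψ)) (hconv : ∀ k, ConvexOn ℝ Set.univ (Ψ k)) {Φ : K → F}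
    (hΦ : ∀ k, argminSet (Ψ k) = {Φ k}) : Continuous Φ := by
  refine continuous_iff_continuousAt.2 fun k₀ => Metric.tendsto_nhds.2 fun e he => ?_
  filter_upwards [eventually_argminSet_subset_ball hΨ (hΦ k₀) he] with k hk
  exact hk (hconv k) ((hΦ k).ge rfl)

lemma eventually_forall_argminSet_subset_ball [ProperSpace F] {Ψ : K → G → F → ℝ}
    (hΨ : Continuous fun q : (K × G) × F => Ψ q.1.1 q.1.2 q.2) {k₀ : K}
    (hconv : ∀ x, ConvexOn ℝ Set.univ (Ψ k₀ x)) {Φ : G → F}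
    (hΦ : ∀ x, argminSet (Ψ k₀ x) = {Φ x}) {S : Set G} (hS : IsCompact S) {e : ℝ} (he : 0 < e) :
    ∀ᶠ k in 𝓝 k₀, ∀ x ∈ S, ConvexOn ℝ Set.univ (Ψ k x) →
      argminSet (Ψ k x) ⊆ Metric.ball (Φ x) e := by
  have hΦ_cont : Continuous Φ :=
    continuous_of_argminSet_eq_singleton (Ψ := Ψ k₀)
      (hΨ.comp (f := fun q : G × F => ((k₀, q.1), q.2)) (by fun_prop)) hconv hΦ
  refine hS.eventually_forall_of_forall_eventually fun x₀ _ => ?_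
  have near_argmin := eventually_argminSet_subset_ball (Ψ := fun q : K × G => Ψ q.1 q.2) hΨ
    (k₀ := (k₀, x₀)) (hΦ x₀) (half_pos he)
  have near_Φ : ∀ᶠ q : K × G in 𝓝 (k₀, x₀), dist (Φ q.2) (Φ x₀) < e / 2 :=
    (hΦ_cont.comp continuous_snd).continuousAt.eventually (Metric.ball_mem_nhds _ (half_pos he))
  filter_upwards [near_argmin, near_Φ] with q hq hqΦ hqconv u hu
  calc dist u (Φ q.2) ≤ dist u (Φ x₀) + dist (Φ q.2) (Φ x₀) := dist_triangle_right _ _ _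
    _ < e / 2 + e / 2 := add_lt_add (hq hqconv hu) hqΦ
    _ = e := add_halves e

lemma exists_argminSet_eq_singleton_of_strongConvexOn [ProperSpace F] {f : F → ℝ} {m : ℝ}
    (hm : 0 < m) (hf : StrongConvexOn Set.univ m f) (hcont : Continuous f) :
    ∃ v, argminSet f = {v} := by
  obtain ⟨x₀, -, hx₀⟩ := (isCompact_closedBall (0 : F) 1).exists_isMinOn
    ⟨0, Metric.mem_closedBall_self zero_le_one⟩ hcont.continuousOn
  have ge_of_norm_ge : ∀ u : F, 1 + 2 * (f 0 - f x₀) / m ≤ ‖u‖ → 1 ≤ ‖u‖ → f 0 ≤ f u := by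
    intro u hu hu_one
    have hpos : 0 < ‖u‖ := one_pos.trans_le hu_one
    have hball : ‖u‖⁻¹ • u ∈ Metric.closedBall (0 : F) 1 := by
      simp [norm_smul, hpos.ne']
    have hmin : f x₀ ≤ f (‖u‖⁻¹ • u) := hx₀ hball
    have hstrong := hf.2 (Set.mem_univ u) (Set.mem_univ 0) (inv_nonneg.2 hpos.le)
      (sub_nonneg.2 (inv_le_one_of_one_le₀ hu_one)) (add_sub_cancel _ _)
    simp only [smul_zero, add_zero, sub_zero, smul_eq_mul] at hstrong
    have hgrowth : ‖u‖ * f x₀ ≤ f u + (‖u‖ - 1) * f 0 - (‖u‖ - 1) * (m / 2 * ‖u‖) := by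
      have := mul_le_mul_of_nonneg_left (hmin.trans hstrong) hpos.le
      field_simp at this ⊢
      linarith
    have hlarge : f 0 - f x₀ ≤ (‖u‖ - 1) * (m / 2) := by
      have := (div_le_iff₀ hm).1 (le_sub_iff_add_le'.2 hu)
      linarith
    nlinarith [mul_le_mul_of_nonneg_left hlarge hpos.le]
  obtain ⟨v, hv⟩ : ∃ v, ∀ u, f v ≤ f u := by
    refine hcont.exists_forall_le' 0 ?_
    filter_upwards [tendsto_norm_cocompact_atTop.eventually_ge_atTop (1 + 2 * (f 0 - f x₀) / m),
      tendsto_norm_cocompact_atTop.eventually_ge_atTop 1] using ge_of_norm_ge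
  refine ⟨v, Set.eq_singleton_iff_unique_mem.2 ⟨hv, fun u hu => ?_⟩⟩
  exact (hf.strictConvexOn hm).eq_of_isMinOn (fun x _ => hu x) (fun x _ => hv x) trivial trivial

end ConvexMinimization

section DifferenceQuotient

lemma mul_mul_dslope_add_mul (f : ℝ → ℝ) (b a x : ℝ) :
    a * (x * dslope f b (b + a * x)) = f (b + a * x) - f b := by
  rw [← mul_assoc, ← sub_smul_dslope, add_sub_cancel_left, smul_eq_mul]

lemma convexOn_mul_dslope {f : ℝ → ℝ} (hf : ConvexOn ℝ Set.univ f) (b : ℝ) {a : ℝ} (ha : 0 ≤ a) :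
    ConvexOn ℝ Set.univ fun x => x * dslope f b (b + a * x) := by
  obtain rfl | hpos := ha.eq_or_lt
  · exact ((LinearMap.mul ℝ ℝ (dslope f b b)).convexOn convex_univ).congr
      fun x _ => by simp [mul_comm]
  · have hline : ConvexOn ℝ Set.univ fun x => f (b + a * x) := by
      simpa [AffineMap.lineMap_apply, mul_comm, add_comm, Function.comp_def] using
        hf.comp_affineMap (AffineMap.lineMap b (b + a))
    refine ((hline.sub (concaveOn_const (f b) convex_univ)).smul (inv_nonneg.2 ha)).congr
      fun x _ => ?_
    simp only [Pi.sub_apply, smul_eq_mul, ← mul_mul_dslope_add_mul, inv_mul_cancel_left₀ hpos.ne']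

lemma continuous_dslope_of_differentiableAt {f : ℝ → ℝ} {b : ℝ} (hf : Continuous f)
    (hfb : DifferentiableAt ℝ f b) : Continuous (dslope f b) :=
  continuousOn_univ.1 <| (continuousOn_dslope univ_mem).2 ⟨hf.continuousOn, hfb⟩

lemma deriv_abs_eq_sign (b : ℝ) : deriv (|·|) b = Real.sign b := by
  obtain hb | rfl | hb := lt_trichotomy b 0
  · rw [deriv_abs_neg hb, Real.sign_of_neg hb]
  · rw [deriv_abs_zero, Real.sign_zero]
  · rw [deriv_abs_pos hb, Real.sign_of_pos hb]

end DifferenceQuotient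

section QuadraticForm

variable {p : ℕ}

lemma quadForm_eq_dotProduct (G : Matrix (Fin p) (Fin p) ℝ) (u : 𝔼 p) :
    quadForm G u = u.ofLp ⬝ᵥ G *ᵥ u.ofLp := by
  simp only [quadForm, dotProduct, Matrix.mulVec, Finset.mul_sum, mul_assoc]

lemma quadForm_smul_matrix (c : ℝ) (G : Matrix (Fin p) (Fin p) ℝ) (u : 𝔼 p) :
    quadForm (c • G) u = c * quadForm G u := by
  simp only [quadForm_eq_dotProduct, Matrix.smul_mulVec, dotProduct_smul, smul_eq_mul]

lemma quadForm_smul (G : Matrix (Fin p) (Fin p) ℝ) (a : ℝ) (u : 𝔼 p) :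
    quadForm G (a • u) = a ^ 2 * quadForm G u := by
  simp only [quadForm_eq_dotProduct, WithLp.ofLp_smul, Matrix.mulVec_smul, dotProduct_smul,
    smul_dotProduct, smul_eq_mul]
  ring

lemma quadForm_nonneg {G : Matrix (Fin p) (Fin p) ℝ} (hG : G.PosSemidef) (u : 𝔼 p) :
    0 ≤ quadForm G u := by
  rw [quadForm_eq_dotProduct]
  exact hG.dotProduct_mulVec_nonneg u.ofLp

@[fun_prop]
lemma continuous_quadForm {T : Type*} [TopologicalSpace T] {G : T → Matrix (Fin p) (Fin p) ℝ}
    {u : T → 𝔼 p} (hG : Continuous G) (hu : Continuous u) :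
    Continuous fun x => quadForm (G x) (u x) := by
  unfold quadForm
  fun_prop

lemma quadForm_smul_add_smul (G : Matrix (Fin p) (Fin p) ℝ) (x y : 𝔼 p) {s r : ℝ}
    (hsr : s + r = 1) :
    quadForm G (s • x + r • y)
      = s * quadForm G x + r * quadForm G y - s * r * quadForm G (x - y) := by
  obtain rfl := eq_sub_of_add_eq' hsr
  simp only [quadForm, Finset.mul_sum, ← Finset.sum_add_distrib, ← Finset.sum_sub_distrib,
    PiLp.add_apply, PiLp.sub_apply, PiLp.smul_apply, smul_eq_mul]
  exact Finset.sum_congr rfl fun i _ => Finset.sum_congr rfl fun j _ => by ring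

lemma strongConvexOn_quadForm {G : Matrix (Fin p) (Fin p) ℝ} {c : ℝ}
    (hG : ∀ u : 𝔼 p, c * ‖u‖ ^ 2 ≤ quadForm G u) :
    StrongConvexOn Set.univ (2 * c) (quadForm G) := by
  refine ⟨convex_univ, fun x _ y _ s r hs hr hsr => ?_⟩
  rw [quadForm_smul_add_smul G x y hsr, mul_div_cancel_left₀ c two_ne_zero]
  exact sub_le_sub_left (by gcongr; exact hG _) _

lemma exists_mul_norm_sq_le_quadForm {C : Matrix (Fin p) (Fin p) ℝ} (hC : C.PosDef) :
    ∃ c > 0, ∀ u : 𝔼 p, c * ‖u‖ ^ 2 ≤ quadForm C u := by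
  have pos_on_sphere : ∀ x ∈ Metric.sphere (0 : 𝔼 p) 1, 0 < quadForm C x := fun x hx => by
    rw [quadForm_eq_dotProduct]
    have hx_ne : x ≠ 0 := ne_zero_of_mem_unit_sphere ⟨x, hx⟩
    exact hC.dotProduct_mulVec_pos ((WithLp.ofLp_eq_zero 2).not.2 hx_ne)
  obtain ⟨c, hc, hc_le⟩ := (isCompact_sphere (0 : 𝔼 p) 1).exists_forall_le'
    (f := quadForm C) (continuous_quadForm continuous_const continuous_id).continuousOn
    pos_on_sphere
  refine ⟨c, hc, fun u => ?_⟩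
  obtain rfl | hu := eq_or_ne u 0
  · simp [quadForm]
  · have := hc_le (‖u‖⁻¹ • u) (by simp [norm_smul, norm_ne_zero_iff.2 hu])
    simp only [quadForm_smul, inv_pow] at this
    rwa [← le_inv_mul_iff₀' (by positivity)]

end QuadraticForm

section LocalCriterion

variable {p : ℕ}

/-- The difference quotient `(‖β + a u‖₁ - ‖β‖₁) / a` of the `ℓ¹` penalty at `β` in the direction
`u`. Dividing coordinatewise through `dslope` gives it a meaning at step size `a = 0`, namely the
directional derivative of the penalty, in such a way that it is continuous in `(a, u)`. -/
noncomputable def penaltyQuotient (β : 𝔼 p) (a : ℝ) (u : 𝔼 p) : ℝ :=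
  ∑ j ∈ activeSet β, u j * dslope (|·|) (β j) (β j + a * u j) + ∑ j ∈ (activeSet β)ᶜ, |u j|

/-- The Transfer Lasso criterion in the local coordinate `u = (b - β) / a`, normalized to vanish
up to the last summand at `u = 0`. Here `G` is the Gram matrix, `κ` and `θ` are the rescaled
regularization parameters, and `w` and `t` are the rescaled score and initial estimation error. The
limit criteria are its instances with step size `a = 0`. -/
noncomputable def localCriterion (β : 𝔼 p) (G : Matrix (Fin p) (Fin p) ℝ) (a κ θ : ℝ)
    (w t u : 𝔼 p) : ℝ :=
  quadForm G u - 2 * ∑ j, u j * w j + κ * penaltyQuotient β a u + θ * ∑ j, |u j - t j|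

lemma mul_penaltyQuotient (β : 𝔼 p) {a : ℝ} (ha : 0 ≤ a) (u : 𝔼 p) :
    a * penaltyQuotient β a u = ∑ j, |β j + a * u j| - ∑ j, |β j| := by
  have inactive : ∀ j ∈ (activeSet β)ᶜ, a * |u j| = |β j + a * u j| - |β j| := fun j hj => by
    have hβj : β j = 0 := by simpa [activeSet] using hj
    rw [hβj, zero_add, abs_zero, sub_zero, abs_mul, abs_of_nonneg ha]
  rw [penaltyQuotient, mul_add, Finset.mul_sum, Finset.mul_sum, Finset.sum_congr rfl inactive,
    ← Finset.sum_sub_distrib]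
  simp only [mul_mul_dslope_add_mul]
  exact Finset.sum_add_sum_compl (activeSet β) fun j => |β j + a * u j| - |β j|

lemma penaltyQuotient_zero (β u : 𝔼 p) :
    penaltyQuotient β 0 u
      = ∑ j ∈ activeSet β, u j * Real.sign (β j) + ∑ j ∈ (activeSet β)ᶜ, |u j| := by
  simp only [penaltyQuotient, zero_mul, add_zero, dslope_same, deriv_abs_eq_sign]

@[fun_prop]
lemma continuous_penaltyQuotient {T : Type*} [TopologicalSpace T] (β : 𝔼 p) {a : T → ℝ}
    {u : T → 𝔼 p} (ha : Continuous a) (hu : Continuous u) :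
    Continuous fun x => penaltyQuotient β (a x) (u x) := by
  refine (continuous_finsetSum _ fun j hj => ?_).add (by fun_prop)
  have hβj : β j ≠ 0 := by simpa [activeSet] using hj
  have hdslope : Continuous (dslope (|·|) (β j)) :=
    continuous_dslope_of_differentiableAt continuous_abs (differentiableAt_abs hβj)
  fun_prop

lemma convexOn_penaltyQuotient (β : 𝔼 p) {a : ℝ} (ha : 0 ≤ a) :
    ConvexOn ℝ Set.univ (penaltyQuotient β a) := by
  have convexOn_coord {f : ℝ → ℝ} (hf : ConvexOn ℝ Set.univ f) (j : Fin p) :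
      ConvexOn ℝ Set.univ fun u : 𝔼 p => f (u j) := hf.comp_linearMap (EuclideanSpace.projₗ j)
  have convexOn_abs : ConvexOn ℝ Set.univ (fun x : ℝ => |x|) := convexOn_univ_norm
  have active := convexOn_univ_sum (activeSet β) fun j _ =>
    convexOn_coord (convexOn_mul_dslope convexOn_abs (β j) ha) j
  exact active.add (convexOn_univ_sum _ fun j _ => convexOn_coord convexOn_abs j)

lemma limitCriterionRootN_eq_localCriterion (C : Matrix (Fin p) (Fin p) ℝ) (β : 𝔼 p)
    (lam0 eta0 r0 : ℝ) (w z : 𝔼 p) :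
    limitCriterionRootN C β lam0 eta0 r0 w z
      = localCriterion β C 0 lam0 eta0 w (Real.sqrt r0 • z) := by
  ext u
  simp only [limitCriterionRootN, localCriterion, penaltyQuotient_zero, PiLp.smul_apply,
    smul_eq_mul]

lemma limitCriterionSlow_eq_localCriterion (C : Matrix (Fin p) (Fin p) ℝ) (β : 𝔼 p) (ρ : ℝ) :
    limitCriterionSlow C β ρ = localCriterion β C 0 1 ρ 0 0 := by
  ext u
  have split := Finset.sum_add_sum_compl (activeSet β) fun j => ρ * |u j|
  simp only [limitCriterionSlow, localCriterion, penaltyQuotient_zero, PiLp.zero_apply, mul_zero,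
    sub_zero, Finset.sum_const_zero, one_mul, add_mul, Finset.sum_add_distrib, Finset.mul_sum,
    ← split]
  ring

@[fun_prop]
lemma continuous_localCriterion {T : Type*} [TopologicalSpace T] (β : 𝔼 p)
    {G : T → Matrix (Fin p) (Fin p) ℝ} {a κ θ : T → ℝ} {w t u : T → 𝔼 p} (hG : Continuous G)
    (ha : Continuous a) (hκ : Continuous κ) (hθ : Continuous θ) (hw : Continuous w)
    (ht : Continuous t) (hu : Continuous u) :
    Continuous fun x => localCriterion β (G x) (a x) (κ x) (θ x) (w x) (t x) (u x) := by
  unfold localCriterion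
  fun_prop

lemma strongConvexOn_localCriterion (β : 𝔼 p) {G : Matrix (Fin p) (Fin p) ℝ} {c : ℝ}
    (hG : ∀ u : 𝔼 p, c * ‖u‖ ^ 2 ≤ quadForm G u) {a κ θ : ℝ} (ha : 0 ≤ a) (hκ : 0 ≤ κ) (hθ : 0 ≤ θ)
    (w t : 𝔼 p) : StrongConvexOn Set.univ (2 * c) (localCriterion β G a κ θ w t) := by
  have hlinear : ConvexOn ℝ Set.univ fun u : 𝔼 p => -(2 * ∑ j, u j * w j) :=
    (((-2 : ℝ) • innerₗ (𝔼 p) w).convexOn convex_univ).congr fun u _ => by simp [PiLp.inner_apply]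
  have hdist : ConvexOn ℝ Set.univ fun u : 𝔼 p => ∑ j, |u j - t j| :=
    convexOn_univ_sum _ fun j _ =>
      (convexOn_univ_dist (t j)).comp_linearMap (EuclideanSpace.projₗ j)
  have hpenalized := (hlinear.add ((convexOn_penaltyQuotient β ha).smul hκ)).add (hdist.smul hθ)
  have hadd := UniformConvexOn.add (strongConvexOn_quadForm hG) (uniformConvexOn_zero.2 hpenalized)
  rw [add_zero] at hadd
  refine (congrArg (StrongConvexOn Set.univ (2 * c)) ?_).mp hadd
  ext u
  simp only [localCriterion, Pi.add_apply, smul_eq_mul]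
  ring

lemma convexOn_localCriterion (β : 𝔼 p) {G : Matrix (Fin p) (Fin p) ℝ} (hG : G.PosSemidef)
    {a κ θ : ℝ} (ha : 0 ≤ a) (hκ : 0 ≤ κ) (hθ : 0 ≤ θ) (w t : 𝔼 p) :
    ConvexOn ℝ Set.univ (localCriterion β G a κ θ w t) := by
  have := strongConvexOn_localCriterion β (c := 0) (by simpa using quadForm_nonneg hG) ha hκ hθ w t
  rwa [mul_zero, strongConvexOn_zero] at this

lemma exists_argminSet_localCriterion_eq_singleton (β : 𝔼 p) {C : Matrix (Fin p) (Fin p) ℝ}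
    (hC : C.PosDef) {a κ θ : ℝ} (ha : 0 ≤ a) (hκ : 0 ≤ κ) (hθ : 0 ≤ θ) (w t : 𝔼 p) :
    ∃ v, argminSet (localCriterion β C a κ θ w t) = {v} := by
  obtain ⟨c, hc, hcC⟩ := exists_mul_norm_sq_le_quadForm hC
  exact exists_argminSet_eq_singleton_of_strongConvexOn (by positivity)
    (strongConvexOn_localCriterion β hcC ha hκ hθ w t)
    (by fun_prop)

end LocalCriterion

section TransferLassoObjective

variable {n p : ℕ}

/-- The score vector `Xᵀ r` of a residual `r`: minus half the gradient of the squared loss. -/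
noncomputable def score (X : Matrix (Fin n) (Fin p) ℝ) (r : Fin n → ℝ) : 𝔼 p :=
  WithLp.toLp 2 (Xᵀ *ᵥ r)

lemma score_sub (X : Matrix (Fin n) (Fin p) ℝ) (r s : Fin n → ℝ) :
    score X (r - s) = score X r - score X s := by
  rw [score, Matrix.mulVec_sub, WithLp.toLp_sub, score, score]

lemma score_mulVec (X : Matrix (Fin n) (Fin p) ℝ) (d : 𝔼 p) :
    score X (X *ᵥ d.ofLp) = WithLp.toLp 2 ((Xᵀ * X) *ᵥ d.ofLp) := by
  rw [score, Matrix.mulVec_mulVec]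

lemma score_dotProduct (X : Matrix (Fin n) (Fin p) ℝ) (r : Fin n → ℝ) (u : 𝔼 p) :
    (score X r).ofLp ⬝ᵥ u.ofLp = r ⬝ᵥ X *ᵥ u.ofLp := by
  rw [score, Matrix.mulVec_transpose, ← Matrix.dotProduct_mulVec]

lemma linearResponse_sub_mulVec (X : Matrix (Fin n) (Fin p) ℝ) (β b : 𝔼 p) (ε : Fin n → ℝ) :
    linearResponse X β ε - X *ᵥ b.ofLp = ε - X *ᵥ (b - β).ofLp := by
  rw [WithLp.ofLp_sub, Matrix.mulVec_sub]
  ext i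
  simp only [linearResponse, Matrix.mulVec, dotProduct, Pi.sub_apply]
  ring

lemma quadForm_transpose_mul_self (X : Matrix (Fin n) (Fin p) ℝ) (u : 𝔼 p) :
    quadForm (Xᵀ * X) u = (X *ᵥ u.ofLp) ⬝ᵥ (X *ᵥ u.ofLp) := by
  rw [quadForm_eq_dotProduct, ← Matrix.mulVec_mulVec, Matrix.dotProduct_mulVec,
    Matrix.vecMul_transpose]

lemma posSemidef_smul_transpose_mul_self (X : Matrix (Fin n) (Fin p) ℝ) {c : ℝ} (hc : 0 ≤ c) :
    (c • (Xᵀ * X)).PosSemidef := by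
  simpa only [Matrix.conjTranspose_eq_transpose_of_trivial] using
    (Matrix.posSemidef_conjTranspose_mul_self X).smul hc

lemma transferLassoObjective_add (X : Matrix (Fin n) (Fin p) ℝ) (y : Fin n → ℝ) (lam eta : ℝ)
    (βinit β d : 𝔼 p) :
    transferLassoObjective X y lam eta βinit (β + d)
      = 1 / n * (∑ i, (y - X *ᵥ β.ofLp) i ^ 2 - 2 * ∑ j, d j * score X (y - X *ᵥ β.ofLp) j
          + quadForm (Xᵀ * X) d)
        + lam / n * ∑ j, |β j + d j| + eta / n * ∑ j, |d j - (βinit - β) j| := by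
  have loss : ∑ i, (y i - ∑ j, X i j * (β + d) j) ^ 2
      = ∑ i, (y - X *ᵥ β.ofLp) i ^ 2 - 2 * ∑ j, d j * score X (y - X *ᵥ β.ofLp) j
          + quadForm (Xᵀ * X) d := by
    have hscore : ∑ j, d j * score X (y - X *ᵥ β.ofLp) j
        = (y - X *ᵥ β.ofLp) ⬝ᵥ X *ᵥ d.ofLp :=
      (dotProduct_comm _ _).trans (score_dotProduct X _ d)
    have hresidual (i : Fin n) :
        y i - ∑ j, X i j * (β + d) j = (y - X *ᵥ β.ofLp) i - (X *ᵥ d.ofLp) i := by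
      simp only [Matrix.mulVec, dotProduct, Pi.sub_apply, PiLp.add_apply, mul_add,
        Finset.sum_add_distrib]
      ring
    rw [hscore, quadForm_transpose_mul_self]
    simp only [hresidual, dotProduct, Finset.mul_sum, ← Finset.sum_add_distrib,
      ← Finset.sum_sub_distrib]
    exact Finset.sum_congr rfl fun i _ => by ring
  have init (j : Fin p) : (β + d) j - βinit j = d j - (βinit - β) j := by
    simp only [PiLp.add_apply, PiLp.sub_apply]
    ring
  simp only [transferLassoObjective, loss, init]
  simp only [PiLp.add_apply]

lemma transferLassoObjective_add_smul (hn : 0 < n) (X : Matrix (Fin n) (Fin p) ℝ)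
    (lam eta : ℝ) (βinit β : 𝔼 p) (ε : Fin n → ℝ) {a : ℝ} (ha : 0 < a) (u : 𝔼 p) :
    transferLassoObjective X (linearResponse X β ε) lam eta βinit (β + a • u)
      = a ^ 2 * localCriterion β ((1 / (n : ℝ)) • (Xᵀ * X)) a (lam / (n * a)) (eta / (n * a))
          ((n * a)⁻¹ • score X ε) (a⁻¹ • (βinit - β)) u
        + (1 / n * ∑ i, ε i ^ 2 + lam / n * ∑ j, |β j|) := by
  have hn' : (n : ℝ) ≠ 0 := Nat.cast_ne_zero.2 hn.ne'
  have residual : linearResponse X β ε - X *ᵥ β.ofLp = ε := by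
    rw [linearResponse_sub_mulVec, sub_self, WithLp.ofLp_zero, Matrix.mulVec_zero, sub_zero]
  have penalty : ∑ j, |β j + a * u j| = ∑ j, |β j| + a * penaltyQuotient β a u := by
    rw [mul_penaltyQuotient β ha.le, add_sub_cancel]
  have init (j : Fin p) : |a * u j - (βinit j - β j)| = a * |u j - a⁻¹ * (βinit j - β j)| := by
    rw [← abs_of_pos ha, ← abs_mul, abs_of_pos ha, mul_sub, mul_inv_cancel_left₀ ha.ne']
  rw [transferLassoObjective_add, residual, localCriterion, quadForm_smul, quadForm_smul_matrix]
  simp only [PiLp.smul_apply, PiLp.sub_apply, smul_eq_mul, penalty, init, mul_assoc,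
    mul_left_comm _ (n * a)⁻¹ _, ← Finset.mul_sum]
  field_simp
  ring

lemma smul_sub_mem_argminSet_localCriterion (hn : 0 < n) {X : Matrix (Fin n) (Fin p) ℝ}
    {lam eta : ℝ} {βinit β b : 𝔼 p} {ε : Fin n → ℝ}
    (hb : b ∈ argminSet (transferLassoObjective X (linearResponse X β ε) lam eta βinit))
    {a : ℝ} (ha : 0 < a) :
    a⁻¹ • (b - β) ∈ argminSet (localCriterion β ((1 / (n : ℝ)) • (Xᵀ * X)) a (lam / (n * a))
      (eta / (n * a)) ((n * a)⁻¹ • score X ε) (a⁻¹ • (βinit - β))) := by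
  intro u
  have hle := hb (β + a • u)
  have b_eq : b = β + a • a⁻¹ • (b - β) := by rw [smul_inv_smul₀ ha.ne', add_sub_cancel]
  rw [b_eq, transferLassoObjective_add_smul hn _ _ _ _ _ _ ha,
    transferLassoObjective_add_smul hn _ _ _ _ _ _ ha] at hle
  exact le_of_mul_le_mul_left (le_of_add_le_add_right hle) (pow_pos ha 2)

lemma eq_init_of_mem_argminSet (hn : 0 < n) {X : Matrix (Fin n) (Fin p) ℝ} {y : Fin n → ℝ}
    {lam eta : ℝ} (hlam : 0 ≤ lam) {βinit b : 𝔼 p}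
    (hb : b ∈ argminSet (transferLassoObjective X y lam eta βinit))
    (hscore : 2 * ‖score X (y - X *ᵥ βinit.ofLp)‖ < eta - lam) : b = βinit := by
  obtain ⟨d, rfl⟩ : ∃ d, b = βinit + d := ⟨b - βinit, (add_sub_cancel _ _).symm⟩
  set s := score X (y - X *ᵥ βinit.ofLp)
  have linear_le : ∑ j, d j * s j ≤ ‖s‖ * ∑ j, |d j| := by
    rw [Finset.mul_sum]
    refine Finset.sum_le_sum fun j _ => ?_
    calc d j * s j ≤ |d j| * |s j| := (le_abs_self _).trans (abs_mul _ _).le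
      _ ≤ ‖s‖ * |d j| := by rw [mul_comm]; gcongr; exact PiLp.norm_apply_le s j
  have penalty_ge : ∑ j, |βinit j| - ∑ j, |d j| ≤ ∑ j, |βinit j + d j| := by
    rw [← Finset.sum_sub_distrib]
    exact Finset.sum_le_sum fun j _ => by simpa using abs_sub_abs_le_abs_sub (βinit j) (-d j)
  have quad_nonneg : 0 ≤ quadForm (Xᵀ * X) d := by
    rw [quadForm_transpose_mul_self]
    exact Finset.sum_nonneg fun i _ => mul_self_nonneg _
  have hle := hb (βinit + 0)
  have quad_zero : quadForm (Xᵀ * X) (0 : 𝔼 p) = 0 := by simp [quadForm]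
  rw [transferLassoObjective_add, transferLassoObjective_add, quad_zero] at hle
  simp only [PiLp.zero_apply, sub_self, zero_mul, sub_zero, add_zero, abs_zero,
    Finset.sum_const_zero, mul_zero] at hle
  have hn' : (0 : ℝ) < n := Nat.cast_pos.2 hn
  field_simp at hle
  have sum_abs_le : (eta - lam - 2 * ‖s‖) * ∑ j, |d j| ≤ 0 := by
    linarith [mul_le_mul_of_nonneg_left penalty_ge hlam]
  have sum_abs_eq_zero : ∑ j, |d j| = 0 :=
    (nonpos_of_mul_nonpos_right sum_abs_le (by linarith)).antisymm (by positivity)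
  have d_eq_zero : d = 0 := by
    ext j
    exact abs_eq_zero.1 ((Finset.sum_eq_zero_iff_of_nonneg fun j _ => abs_nonneg (d j)).1
      sum_abs_eq_zero j (Finset.mem_univ j))
  rw [d_eq_zero, add_zero]

end TransferLassoObjective

section Distribution

variable {Ω Ω' : Type*} [MeasurableSpace Ω] [MeasurableSpace Ω'] {μ : Measure Ω} {ν : Measure Ω'}

lemma tendsto_measure_of_isTightMeasureSet {T : Type*} [TopologicalSpace T] [T2Space T]
    [MeasurableSpace T] [OpensMeasurableSpace T] {V : ℕ → Ω → T}
    (hV_meas : ∀ n, AEMeasurable (V n) μ) (hV : IsTightMeasureSet (Set.range fun n => μ.map (V n)))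
    {A : ℕ → Set Ω}
    (hA : ∀ S : Set T, IsCompact S → ∀ᶠ n in atTop, ∀ᵐ ω ∂μ, V n ω ∈ S → ω ∉ A n) :
    Tendsto (fun n => μ (A n)) atTop (𝓝 0) := by
  refine ENNReal.tendsto_nhds_zero.2 fun δ hδ => ?_
  obtain ⟨S, hS, hSδ⟩ := isTightMeasureSet_iff_exists_isCompact_measure_compl_le.1 hV δ hδ
  filter_upwards [hA S hS] with n hn
  calc μ (A n) ≤ μ (V n ⁻¹' Sᶜ) := measure_mono_ae (hn.mono fun ω hω hωA hωS => hω hωS hωA)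
    _ = μ.map (V n) Sᶜ :=
      (Measure.map_apply_of_aemeasurable (hV_meas n) hS.isClosed.isOpen_compl.measurableSet).symm
    _ ≤ δ := hSδ _ ⟨n, rfl⟩

lemma isTightMeasureSet_map_prodMk {S T : Type*} [TopologicalSpace S] [MeasurableSpace S]
    [TopologicalSpace T] [MeasurableSpace T] {V : ℕ → Ω → S} {Y : ℕ → Ω → T}
    (hV_meas : ∀ n, AEMeasurable (V n) μ) (hY_meas : ∀ n, AEMeasurable (Y n) μ)
    (hV : IsTightMeasureSet (Set.range fun n => μ.map (V n)))
    (hY : IsTightMeasureSet (Set.range fun n => μ.map (Y n))) :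
    IsTightMeasureSet (Set.range fun n => μ.map fun ω => (V n ω, Y n ω)) := by
  refine IsTightMeasureSet.prodMk (hV.subset ?_) (hY.subset ?_)
  · rintro _ ⟨_, ⟨n, rfl⟩, rfl⟩
    exact ⟨n, (Measure.fst_map_prodMk₀ (hY_meas n)).symm⟩
  · rintro _ ⟨_, ⟨n, rfl⟩, rfl⟩
    exact ⟨n, (Measure.snd_map_prodMk₀ (hV_meas n)).symm⟩

variable [IsProbabilityMeasure μ] [IsProbabilityMeasure ν] {F G : Type*} [NormedAddCommGroup F]
  [MeasurableSpace F] [BorelSpace F] [SecondCountableTopology F] [NormedAddCommGroup G]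
  [MeasurableSpace G] [BorelSpace G] [SecondCountableTopology G]

lemma isTightMeasureSet_of_tendstoInDistribution [CompleteSpace F] {V : ℕ → Ω → F} {V' : Ω' → F}
    (hV : TendstoInDistribution V atTop V' (fun _ => μ) ν) :
    IsTightMeasureSet (Set.range fun n => μ.map (V n)) := by
  refine (isTightMeasureSet_of_isCompact_closure
    hV.tendsto.isCompact_insert_range.closure).subset ?_
  rintro _ ⟨n, rfl⟩
  exact ⟨_, Set.mem_insert_of_mem _ ⟨n, rfl⟩, rfl⟩

lemma tendstoInDistribution_prodMk_of_indepFun {V : ℕ → Ω → F} {V' : Ω' → F} {Y : ℕ → Ω → G}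
    {Y' : Ω' → G} (hV : TendstoInDistribution V atTop V' (fun _ => μ) ν)
    (hY : TendstoInDistribution Y atTop Y' (fun _ => μ) ν)
    (hVY : ∀ n, IndepFun (V n) (Y n) μ) (hVY' : IndepFun V' Y' ν) :
    TendstoInDistribution (fun n ω => (V n ω, Y n ω)) atTop (fun ω => (V' ω, Y' ω))
      (fun _ => μ) ν where
  forall_aemeasurable n := (hV.forall_aemeasurable n).prodMk (hY.forall_aemeasurable n)
  aemeasurable_limit := hV.aemeasurable_limit.prodMk hY.aemeasurable_limit
  tendsto := by
    have hprod := (ProbabilityMeasure.continuous_prod.tendsto _).comp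
      (hV.tendsto.prodMk_nhds hY.tendsto)
    refine Tendsto.congr (fun n => Subtype.ext ?_)
      (hprod.mono_right (le_of_eq (congrArg 𝓝 (Subtype.ext ?_))))
    · exact ((hVY n).map_prod_eq_prod_map_map (hV.forall_aemeasurable n)
        (hY.forall_aemeasurable n)).symm
    · exact (hVY'.map_prod_eq_prod_map_map hV.aemeasurable_limit hY.aemeasurable_limit).symm

lemma tendstoInDistribution_smul [NormedSpace ℝ F] {V : ℕ → Ω → F} {V' : Ω' → F}
    (hV : TendstoInDistribution V atTop V' (fun _ => μ) ν) {s : ℕ → ℝ} {s₀ : ℝ}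
    (hs : Tendsto s atTop (𝓝 s₀)) :
    TendstoInDistribution (fun n ω => s n • V n ω) atTop (fun ω => s₀ • V' ω) (fun _ => μ) ν :=
  hV.continuous_comp_prodMk_of_tendstoInMeasure_const (g := fun x : F × ℝ => x.2 • x.1)
    (by fun_prop)
    (tendstoInMeasure_of_tendsto_ae (fun _ => aestronglyMeasurable_const) (ae_of_all _ fun _ => hs))
    (fun _ => aemeasurable_const)

lemma tendstoInMeasure_smul_zero [NormedSpace ℝ F] [CompleteSpace F] {V : ℕ → Ω → F} {V' : Ω' → F}
    (hV : TendstoInDistribution V atTop V' (fun _ => μ) ν) {s : ℕ → ℝ}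
    (hs : Tendsto s atTop (𝓝 0)) :
    TendstoInMeasure μ (fun n ω => s n • V n ω) atTop fun _ => 0 := by
  rw [tendstoInMeasure_iff_norm]
  intro e he
  refine tendsto_measure_of_isTightMeasureSet hV.forall_aemeasurable
    (isTightMeasureSet_of_tendstoInDistribution hV) fun S hS => ?_
  have small_on_compact : ∀ᶠ r in 𝓝 (0 : ℝ), ∀ x ∈ S, ‖r • x‖ < e :=
    hS.eventually_forall_of_forall_eventually fun x _ => by
      have hcont : Continuous fun q : ℝ × F => ‖q.1 • q.2‖ := by fun_prop
      exact hcont.continuousAt.eventually_lt continuousAt_const (by simpa using he)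
  filter_upwards [hs.eventually small_on_compact] with n hn
  refine ae_of_all _ fun ω hω => ?_
  simpa using hn _ hω

theorem tendstoInDistribution_argmin [CompleteSpace G] [NormedSpace ℝ F] [ProperSpace F]
    {K : Type*} [TopologicalSpace K] {Ψ : K → G → F → ℝ}
    (hΨ : Continuous fun q : (K × G) × F => Ψ q.1.1 q.1.2 q.2) {k : ℕ → K} {k₀ : K}
    (hk : Tendsto k atTop (𝓝 k₀)) (hconv : ∀ᶠ n in atTop, ∀ x, ConvexOn ℝ Set.univ (Ψ (k n) x))
    (hconv₀ : ∀ x, ConvexOn ℝ Set.univ (Ψ k₀ x)) {Φ : G → F}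
    (hΦ : ∀ x, argminSet (Ψ k₀ x) = {Φ x}) {V : ℕ → Ω → G} {V' : Ω' → G}
    (hV : TendstoInDistribution V atTop V' (fun _ => μ) ν) {U : ℕ → Ω → F}
    (hU_meas : ∀ n, AEMeasurable (U n) μ)
    (hU : ∀ᶠ n in atTop, ∀ᵐ ω ∂μ, U n ω ∈ argminSet (Ψ (k n) (V n ω))) :
    TendstoInDistribution U atTop (fun ω => Φ (V' ω)) (fun _ => μ) ν := by
  have hΦ_cont : Continuous Φ :=
    continuous_of_argminSet_eq_singleton (Ψ := Ψ k₀)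
      (hΨ.comp (f := fun q : G × F => ((k₀, q.1), q.2)) (by fun_prop)) hconv₀ hΦ
  refine tendstoInDistribution_of_tendstoInMeasure_sub U _ (hV.continuous_comp hΦ_cont) ?_ hU_meas
  rw [tendstoInMeasure_iff_norm]
  intro e he
  refine tendsto_measure_of_isTightMeasureSet hV.forall_aemeasurable
    (isTightMeasureSet_of_tendstoInDistribution hV) fun S hS => ?_
  filter_upwards [hU, hconv, hk.eventually
    (eventually_forall_argminSet_subset_ball hΨ hconv₀ hΦ hS he)] with n hnU hnconv hnball
  filter_upwards [hnU] with ω hω hωS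
  have hclose : dist (U n ω) (Φ (V n ω)) < e := hnball _ hωS (hnconv _) hω
  simpa [dist_eq_norm] using hclose

end Distribution

section GaussianScore

variable {Ω Ω' : Type*} [MeasurableSpace Ω] [MeasurableSpace Ω'] {μ : Measure Ω} {ν : Measure Ω'}
  [IsProbabilityMeasure μ]

lemma tendstoInDistribution_of_hasLaw_multivariateGaussian {ι : Type*} [Fintype ι] [DecidableEq ι]
    [IsProbabilityMeasure ν] {m : ℕ → EuclideanSpace ℝ ι} {m₀ : EuclideanSpace ℝ ι}
    (hm : Tendsto m atTop (𝓝 m₀)) {S : ℕ → Matrix ι ι ℝ} {S₀ : Matrix ι ι ℝ}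
    (hS : Tendsto S atTop (𝓝 S₀)) (hS_psd : ∀ n, (S n).PosSemidef) (hS₀ : S₀.PosSemidef)
    {Y : ℕ → Ω → EuclideanSpace ℝ ι} {W : Ω' → EuclideanSpace ℝ ι}
    (hY : ∀ n, HasLaw (Y n) (multivariateGaussian (m n) (S n)) μ)
    (hW : HasLaw W (multivariateGaussian m₀ S₀) ν) :
    TendstoInDistribution Y atTop W (fun _ => μ) ν := by
  refine ⟨fun n => (hY n).aemeasurable, hW.aemeasurable,
    ProbabilityMeasure.tendsto_iff_tendsto_charFun.2 fun t => ?_⟩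
  have hcont : Continuous fun q : EuclideanSpace ℝ ι × Matrix ι ι ℝ =>
      Complex.exp (inner ℝ t q.1 * Complex.I - (t ⬝ᵥ q.2 *ᵥ t : ℝ) / 2) := by
    fun_prop
  have hlim := (hcont.tendsto (m₀, S₀)).comp (hm.prodMk_nhds hS)
  simp only [ProbabilityMeasure.coe_mk, hW.map_eq, charFun_multivariateGaussian hS₀]
  refine hlim.congr fun n => ?_
  rw [(hY n).map_eq, charFun_multivariateGaussian (hS_psd n)]
  rfl

variable {p : ℕ}

lemma continuous_score {n : ℕ} (X : Matrix (Fin n) (Fin p) ℝ) : Continuous (score X) := by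
  unfold score
  fun_prop

lemma hasLaw_score {n : ℕ} (X : Matrix (Fin n) (Fin p) ℝ) {ε : Fin n → Ω → ℝ} {v : NNReal}
    (hlaw : ∀ i, HasLaw (ε i) (gaussianReal 0 v) μ) (hindep : iIndepFun ε μ) :
    HasLaw (fun ω => score X fun i => ε i ω)
      (multivariateGaussian 0 ((v : ℝ) • (Xᵀ * X))) μ := by
  have hε : AEMeasurable (fun ω i => ε i ω) μ :=
    aemeasurable_pi_lambda _ fun i => (hlaw i).aemeasurable
  have hscore : AEMeasurable (fun ω => score X fun i => ε i ω) μ :=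
    (continuous_score X).measurable.comp_aemeasurable hε
  have hgram : ((v : ℝ) • (Xᵀ * X)).PosSemidef := posSemidef_smul_transpose_mul_self X v.2
  have := Measure.isProbabilityMeasure_map hscore
  refine ⟨hscore, Measure.ext_of_charFun (funext fun t => ?_)⟩
  have transpose_charFun : charFun (μ.map fun ω => score X fun i => ε i ω) t
      = charFun (μ.map fun ω => WithLp.toLp 2 (ε · ω)) (WithLp.toLp 2 (X *ᵥ t.ofLp)) := by
    rw [charFun_apply, charFun_apply, integral_map hscore (by fun_prop),
      integral_map (by fun_prop) (by fun_prop)]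
    simp only [EuclideanSpace.inner_eq_star_dotProduct, star_trivial, dotProduct_comm t.ofLp,
      dotProduct_comm (X *ᵥ t.ofLp), score_dotProduct]
  rw [transpose_charFun, (iIndepFun_iff_charFun_pi fun i => (hlaw i).aemeasurable).1 hindep,
    charFun_multivariateGaussian hgram]
  simp only [(hlaw _).map_eq, charFun_gaussianReal, ← Complex.exp_sum]
  rw [← quadForm_eq_dotProduct, quadForm_smul_matrix, quadForm_transpose_mul_self, dotProduct]
  simp only [inner_zero_right, Complex.ofReal_zero, mul_zero, zero_mul, zero_sub,
    Complex.ofReal_mul, Complex.ofReal_sum, Finset.sum_neg_distrib, Finset.mul_sum,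
    Finset.sum_div, pow_two]

lemma tendstoInDistribution_score [IsProbabilityMeasure ν] {X : (n : ℕ) → Matrix (Fin n) (Fin p) ℝ}
    {C : Matrix (Fin p) (Fin p) ℝ} (hC : C.PosSemidef)
    (hXC : Tendsto (fun n : ℕ => (1 / (n : ℝ)) • ((X n)ᵀ * X n)) atTop (𝓝 C))
    {ε : (n : ℕ) → Fin n → Ω → ℝ} {v : NNReal}
    (hlaw : ∀ n i, HasLaw (ε n i) (gaussianReal 0 v) μ) (hindep : ∀ n, iIndepFun (ε n) μ)
    {W : Ω' → 𝔼 p} (hW : HasLaw W (multivariateGaussian 0 ((v : ℝ) • C)) ν) :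
    TendstoInDistribution (fun (n : ℕ) ω => (Real.sqrt n)⁻¹ • score (X n) fun i => ε n i ω)
      atTop W (fun _ => μ) ν := by
  have rescale (n : ℕ) (r : Fin n → ℝ) :
      (Real.sqrt n)⁻¹ • score (X n) r = score ((Real.sqrt n)⁻¹ • X n) r := by
    rw [score, score, Matrix.transpose_smul, Matrix.smul_mulVec, WithLp.toLp_smul]
  have gram (n : ℕ) : ((Real.sqrt n)⁻¹ • X n)ᵀ * ((Real.sqrt n)⁻¹ • X n)
      = (1 / (n : ℝ)) • ((X n)ᵀ * X n) := by
    rw [Matrix.transpose_smul, Matrix.smul_mul, Matrix.mul_smul, smul_smul, ← mul_inv,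
      Real.mul_self_sqrt n.cast_nonneg, one_div]
  simp only [rescale]
  refine tendstoInDistribution_of_hasLaw_multivariateGaussian tendsto_const_nhds
    ((hXC.congr fun n => (gram n).symm).const_smul (v : ℝ))
    (fun n => posSemidef_smul_transpose_mul_self _ v.2) (hC.smul v.2)
    (fun n => hasLaw_score _ (hlaw n) (hindep n)) hW

end GaussianScore

section TransferLassoAsymptotics

variable {Ω Ω' : Type*} [MeasurableSpace Ω] [MeasurableSpace Ω'] {μ : Measure Ω}
  {ν : Measure Ω'} {p : ℕ}

variable {X : (n : ℕ) → Matrix (Fin n) (Fin p) ℝ} {C : Matrix (Fin p) (Fin p) ℝ} {β : 𝔼 p}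
  {ε : (n : ℕ) → Fin n → Ω → ℝ} {βinit βhat : ℕ → Ω → 𝔼 p} {lam eta : ℕ → ℝ}

lemma sqrt_div_smul_sqrt_smul {n m : ℕ} (hm : 0 < m) (d : 𝔼 p) :
    Real.sqrt (n / m) • Real.sqrt m • d = Real.sqrt n • d := by
  have hm' : (m : ℝ) ≠ 0 := Nat.cast_ne_zero.2 hm.ne'
  rw [smul_smul, ← Real.sqrt_mul (by positivity), div_mul_cancel₀ _ hm']

lemma tendsto_eta_sub_lam_div_sqrt {rho0 : ℝ} (hrho0 : rho0 < 1)
    (heta : Tendsto (fun n : ℕ => eta n / Real.sqrt n) atTop atTop)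
    (hratio : Tendsto (fun n : ℕ => lam n / eta n) atTop (𝓝 rho0)) :
    Tendsto (fun n : ℕ => (eta n - lam n) / Real.sqrt n) atTop atTop := by
  refine (heta.atTop_mul_pos (sub_pos.2 hrho0) (hratio.const_sub 1)).congr' ?_
  filter_upwards [heta.eventually_ne_atTop 0] with n hn
  have heta_ne : eta n ≠ 0 := fun h => hn (by rw [h, zero_div])
  field_simp

lemma exists_eventually_forall_lt_of_isCompact {K S : Type*} [TopologicalSpace K]
    [TopologicalSpace S] {s : Set S} (hs : IsCompact s) (k₀ : K) {f : K × S → ℝ}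
    (hf : Continuous f) : ∃ M, ∀ᶠ k in 𝓝 k₀, ∀ x ∈ s, f (k, x) < M := by
  obtain ⟨M, hM⟩ := hs.bddAbove_image (f := fun x => f (k₀, x)) (by fun_prop)
  refine ⟨M + 1, hs.eventually_forall_of_forall_eventually fun x hx => ?_⟩
  exact hf.continuousAt.eventually_lt continuousAt_const
    ((hM (Set.mem_image_of_mem _ hx)).trans_lt (lt_add_one M))

lemma inv_sqrt_smul_score_residual {n : ℕ} (X : Matrix (Fin n) (Fin p) ℝ) (β b : 𝔼 p)
    (ε : Fin n → ℝ) :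
    (Real.sqrt n)⁻¹ • score X (linearResponse X β ε - X *ᵥ b.ofLp)
      = (Real.sqrt n)⁻¹ • score X ε
        - WithLp.toLp 2 (((1 / (n : ℝ)) • (Xᵀ * X)) *ᵥ (Real.sqrt n • (b - β)).ofLp) := by
  have scale : 1 / (n : ℝ) * Real.sqrt n = (Real.sqrt n)⁻¹ := by
    rw [one_div_mul_eq_div, Real.sqrt_div_self]
  rw [linearResponse_sub_mulVec, score_sub, score_mulVec, smul_sub, Matrix.smul_mulVec,
    WithLp.ofLp_smul, Matrix.mulVec_smul, smul_smul, scale, WithLp.toLp_smul]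

theorem tendsto_measure_estimator_ne_init
    (hXC : Tendsto (fun n : ℕ => (1 / (n : ℝ)) • ((X n)ᵀ * X n)) atTop (𝓝 C))
    (hlam : ∀ n, 0 ≤ lam n)
    (hβhat : ∀ n, ∀ᵐ ω ∂μ, βhat n ω ∈ argminSet (transferLassoObjective (X n)
      (linearResponse (X n) β fun i => ε n i ω) (lam n) (eta n) (βinit n ω)))
    (hdom : Tendsto (fun n : ℕ => (eta n - lam n) / Real.sqrt n) atTop atTop)
    {T : ℕ → Ω → 𝔼 p} (hT_eq : ∀ᶠ n : ℕ in atTop, ∀ ω, T n ω = Real.sqrt n • (βinit n ω - β))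
    (hT_meas : ∀ n, AEMeasurable (T n) μ)
    (hT : IsTightMeasureSet (Set.range fun n => μ.map (T n)))
    (hS_meas : ∀ n : ℕ, AEMeasurable (fun ω => (Real.sqrt n)⁻¹ • score (X n) fun i => ε n i ω) μ)
    (hS : IsTightMeasureSet
      (Set.range fun n : ℕ => μ.map fun ω => (Real.sqrt n)⁻¹ • score (X n) fun i => ε n i ω)) :
    Tendsto (fun n => μ {ω | βhat n ω ≠ βinit n ω}) atTop (𝓝 0) := by
  refine tendsto_measure_of_isTightMeasureSet (fun n => (hT_meas n).prodMk (hS_meas n))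
    (isTightMeasureSet_map_prodMk hT_meas hS_meas hT hS) fun K hK => ?_
  obtain ⟨M, hM⟩ := exists_eventually_forall_lt_of_isCompact hK C
    (f := fun q : Matrix (Fin p) (Fin p) ℝ × (𝔼 p × 𝔼 p) =>
      ‖q.2.2 - WithLp.toLp 2 (q.1 *ᵥ q.2.1.ofLp)‖) (by fun_prop)
  filter_upwards [hXC.eventually hM, hdom.eventually_ge_atTop (2 * M), hT_eq,
    eventually_gt_atTop 0] with n hnM hndom hTn hn
  filter_upwards [hβhat n] with ω hω hωK
  have sqrt_pos : 0 < Real.sqrt n := Real.sqrt_pos.2 (Nat.cast_pos.2 hn)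
  have hscore := hnM _ hωK
  rw [hTn, ← inv_sqrt_smul_score_residual, norm_smul_of_nonneg (by positivity),
    inv_mul_lt_iff₀ sqrt_pos] at hscore
  rw [le_div_iff₀ sqrt_pos] at hndom
  exact not_not.2 (eq_init_of_mem_argminSet hn (hlam n) hω (by linarith))

variable [IsProbabilityMeasure μ] [IsProbabilityMeasure ν]

theorem tendstoInDistribution_rescaled_estimator (hC : C.PosDef)
    (hXC : Tendsto (fun n : ℕ => (1 / (n : ℝ)) • ((X n)ᵀ * X n)) atTop (𝓝 C))
    (hlam : ∀ n, 0 ≤ lam n) (heta : ∀ n, 0 ≤ eta n) (hβhat_meas : ∀ n, AEMeasurable (βhat n) μ)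
    (hβhat : ∀ n, ∀ᵐ ω ∂μ, βhat n ω ∈ argminSet (transferLassoObjective (X n)
      (linearResponse (X n) β fun i => ε n i ω) (lam n) (eta n) (βinit n ω)))
    {a : ℕ → ℝ} (ha_pos : ∀ᶠ n in atTop, 0 < a n) (ha : Tendsto a atTop (𝓝 0)) {κ θ : ℝ}
    (hκ : Tendsto (fun n : ℕ => lam n / ((n : ℝ) * a n)) atTop (𝓝 κ))
    (hθ : Tendsto (fun n : ℕ => eta n / ((n : ℝ) * a n)) atTop (𝓝 θ))
    {T S : ℕ → Ω → 𝔼 p} (hT : ∀ᶠ n in atTop, ∀ ω, T n ω = (a n)⁻¹ • (βinit n ω - β))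
    (hS : ∀ᶠ n : ℕ in atTop, ∀ ω, S n ω = ((n : ℝ) * a n)⁻¹ • score (X n) fun i => ε n i ω)
    {T₀ S₀ : Ω' → 𝔼 p}
    (hTS : TendstoInDistribution (fun n ω => (T n ω, S n ω)) atTop (fun ω => (T₀ ω, S₀ ω))
      (fun _ => μ) ν)
    {U : Ω' → 𝔼 p} (hU : ∀ ω, argminSet (localCriterion β C 0 κ θ (S₀ ω) (T₀ ω)) = {U ω}) :
    TendstoInDistribution (fun n ω => (a n)⁻¹ • (βhat n ω - β)) atTop U (fun _ => μ) ν := by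
  have na_nonneg : ∀ᶠ n : ℕ in atTop, 0 ≤ n * a n :=
    ha_pos.mono fun n hn => mul_nonneg n.cast_nonneg hn.le
  have hκ₀ : 0 ≤ κ := ge_of_tendsto hκ (na_nonneg.mono fun n hn => div_nonneg (hlam n) hn)
  have hθ₀ : 0 ≤ θ := ge_of_tendsto hθ (na_nonneg.mono fun n hn => div_nonneg (heta n) hn)
  choose Φ hΦ using fun x : 𝔼 p × 𝔼 p =>
    exists_argminSet_localCriterion_eq_singleton β hC le_rfl hκ₀ hθ₀ x.2 x.1
  obtain rfl : U = fun ω => Φ (T₀ ω, S₀ ω) :=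
    funext fun ω => Set.singleton_injective ((hU ω).symm.trans (hΦ (T₀ ω, S₀ ω)))
  refine tendstoInDistribution_argmin
    (Ψ := fun (k : Matrix (Fin p) (Fin p) ℝ × ℝ × ℝ × ℝ) (x : 𝔼 p × 𝔼 p) =>
      localCriterion β k.1 k.2.1 k.2.2.1 k.2.2.2 x.2 x.1) (by fun_prop)
    (hXC.prodMk_nhds (ha.prodMk_nhds (hκ.prodMk_nhds hθ))) ?_
    (fun x => convexOn_localCriterion β hC.posSemidef le_rfl hκ₀ hθ₀ _ _) hΦ hTS
    (fun n => ((hβhat_meas n).sub_const β).fun_const_smul _) ?_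
  · filter_upwards [ha_pos, na_nonneg] with n hn hna x
    exact convexOn_localCriterion β (posSemidef_smul_transpose_mul_self _ (by positivity)) hn.le
      (div_nonneg (hlam n) hna) (div_nonneg (heta n) hna) _ _
  · filter_upwards [ha_pos, hT, hS, eventually_gt_atTop 0] with n hn hTn hSn hn0
    filter_upwards [hβhat n] with ω hω
    simpa only [hTn, hSn] using smul_sub_mem_argminSet_localCriterion hn0 hω hn

variable {v : NNReal} {m : ℕ → ℕ} {r0 : ℝ} {Z W : Ω' → 𝔼 p}

theorem tendstoInDistribution_estimator_of_eta_dominant (hC : C.PosSemidef)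
    (hXC : Tendsto (fun n : ℕ => (1 / (n : ℝ)) • ((X n)ᵀ * X n)) atTop (𝓝 C))
    (hlaw : ∀ n i, HasLaw (ε n i) (gaussianReal 0 v) μ) (hindep : ∀ n, iIndepFun (ε n) μ)
    (hm : ∀ᶠ n in atTop, 0 < m n)
    (hr0 : Tendsto (fun n : ℕ => (n : ℝ) / (m n : ℝ)) atTop (𝓝 r0))
    (hinit : TendstoInDistribution (fun n ω => Real.sqrt (m n) • (βinit n ω - β)) atTop Z
      (fun _ => μ) ν)
    (hlam : ∀ n, 0 ≤ lam n) (hβhat_meas : ∀ n, AEMeasurable (βhat n) μ)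
    (hβhat : ∀ n, ∀ᵐ ω ∂μ, βhat n ω ∈ argminSet (transferLassoObjective (X n)
      (linearResponse (X n) β fun i => ε n i ω) (lam n) (eta n) (βinit n ω)))
    {rho0 : ℝ} (hrho0 : rho0 < 1) (heta : Tendsto (fun n : ℕ => eta n / Real.sqrt n) atTop atTop)
    (hratio : Tendsto (fun n : ℕ => lam n / eta n) atTop (𝓝 rho0)) :
    TendstoInDistribution (fun n ω => Real.sqrt (m n) • (βhat n ω - β)) atTop Z
      (fun _ => μ) ν := by
  have hT := tendstoInDistribution_smul hinit hr0.sqrt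
  have hS := tendstoInDistribution_score hC hXC hlaw hindep HasLaw.id
  have estimator_ne_init := tendsto_measure_estimator_ne_init hXC hlam hβhat
    (tendsto_eta_sub_lam_div_sqrt hrho0 heta hratio)
    (hm.mono fun n hn ω => sqrt_div_smul_sqrt_smul hn (βinit n ω - β))
    hT.forall_aemeasurable (isTightMeasureSet_of_tendstoInDistribution hT)
    hS.forall_aemeasurable (isTightMeasureSet_of_tendstoInDistribution hS)
  refine tendstoInDistribution_of_tendstoInMeasure_sub _ _ hinit ?_
    fun n => ((hβhat_meas n).sub_const β).fun_const_smul _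
  rw [tendstoInMeasure_iff_norm]
  refine fun e he => tendsto_of_tendsto_of_tendsto_of_le_of_le tendsto_const_nhds
    estimator_ne_init (fun _ => zero_le) fun n => measure_mono fun ω hω heq => ?_
  simp only [Pi.sub_apply, Pi.zero_apply, heq, sub_self, norm_zero, Set.mem_ofPred_eq] at hω
  exact hω.not_gt he

lemma exists_argminSet_limitCriterionRootN_eq_singleton (hC : C.PosDef) {lam0 eta0 : ℝ}
    (hlam0 : 0 ≤ lam0) (heta0 : 0 ≤ eta0) (w z : 𝔼 p) :
    ∃ u, argminSet (limitCriterionRootN C β lam0 eta0 r0 w z) = {u} := by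
  rw [limitCriterionRootN_eq_localCriterion]
  exact exists_argminSet_localCriterion_eq_singleton β hC le_rfl hlam0 heta0 _ _

lemma exists_argminSet_limitCriterionSlow_eq_singleton (hC : C.PosDef) {ρ : ℝ} (hρ : 0 ≤ ρ) :
    ∃ u, argminSet (limitCriterionSlow C β ρ) = {u} := by
  rw [limitCriterionSlow_eq_localCriterion]
  exact exists_argminSet_localCriterion_eq_singleton β hC le_rfl zero_le_one hρ _ _

theorem tendstoInDistribution_estimator_rootN (hC : C.PosDef)
    (hXC : Tendsto (fun n : ℕ => (1 / (n : ℝ)) • ((X n)ᵀ * X n)) atTop (𝓝 C))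
    (hlaw : ∀ n i, HasLaw (ε n i) (gaussianReal 0 v) μ) (hindep : ∀ n, iIndepFun (ε n) μ)
    (hm : ∀ᶠ n in atTop, 0 < m n)
    (hr0 : Tendsto (fun n : ℕ => (n : ℝ) / (m n : ℝ)) atTop (𝓝 r0))
    (hinit : TendstoInDistribution (fun n ω => Real.sqrt (m n) • (βinit n ω - β)) atTop Z
      (fun _ => μ) ν)
    (hsource : ∀ n, IndepFun (βinit n) (fun ω i => ε n i ω) μ)
    (hlam : ∀ n, 0 ≤ lam n) (heta : ∀ n, 0 ≤ eta n) (hβhat_meas : ∀ n, AEMeasurable (βhat n) μ)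
    (hβhat : ∀ n, ∀ᵐ ω ∂μ, βhat n ω ∈ argminSet (transferLassoObjective (X n)
      (linearResponse (X n) β fun i => ε n i ω) (lam n) (eta n) (βinit n ω)))
    {lam0 eta0 : ℝ} (hlam0 : Tendsto (fun n : ℕ => lam n / Real.sqrt n) atTop (𝓝 lam0))
    (heta0 : Tendsto (fun n : ℕ => eta n / Real.sqrt n) atTop (𝓝 eta0))
    (hW : HasLaw W (multivariateGaussian 0 ((v : ℝ) • C)) ν) (hWZ : IndepFun W Z ν)
    {U : Ω' → 𝔼 p}
    (hU : ∀ ω, argminSet (limitCriterionRootN C β lam0 eta0 r0 (W ω) (Z ω)) = {U ω}) :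
    TendstoInDistribution (fun (n : ℕ) ω => Real.sqrt n • (βhat n ω - β)) atTop U
      (fun _ => μ) ν := by
  have hTS := tendstoInDistribution_prodMk_of_indepFun (tendstoInDistribution_smul hinit hr0.sqrt)
    (tendstoInDistribution_score hC.posSemidef hXC hlaw hindep hW)
    (fun n => (hsource n).comp
      (φ := fun b => Real.sqrt (n / m n) • Real.sqrt (m n) • (b - β))
      (ψ := fun r => (Real.sqrt n)⁻¹ • score (X n) r) (by fun_prop)
      ((continuous_score (X n)).measurable.fun_const_smul _))
    (hWZ.symm.comp (φ := fun z => Real.sqrt r0 • z) (by fun_prop) measurable_id)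
  simp only [limitCriterionRootN_eq_localCriterion] at hU
  have sqrt_tendsto : Tendsto (fun n : ℕ => Real.sqrt n) atTop atTop :=
    Real.tendsto_sqrt_atTop.comp tendsto_natCast_atTop_atTop
  have n_mul_inv_sqrt (n : ℕ) : (n : ℝ) * (Real.sqrt n)⁻¹ = Real.sqrt n := Real.div_sqrt
  simpa only [inv_inv] using tendstoInDistribution_rescaled_estimator hC hXC hlam heta hβhat_meas
    hβhat (a := fun n => (Real.sqrt n)⁻¹)
    ((sqrt_tendsto.eventually_gt_atTop 0).mono fun n hn => inv_pos.2 hn)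
    sqrt_tendsto.inv_tendsto_atTop (by simpa only [n_mul_inv_sqrt] using hlam0)
    (by simpa only [n_mul_inv_sqrt] using heta0)
    (hm.mono fun n hn ω => by rw [inv_inv, sqrt_div_smul_sqrt_smul hn])
    (.of_forall fun n ω => by rw [n_mul_inv_sqrt]) hTS hU

theorem tendstoInDistribution_estimator_slow (hC : C.PosDef)
    (hXC : Tendsto (fun n : ℕ => (1 / (n : ℝ)) • ((X n)ᵀ * X n)) atTop (𝓝 C))
    (hlaw : ∀ n i, HasLaw (ε n i) (gaussianReal 0 v) μ) (hindep : ∀ n, iIndepFun (ε n) μ)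
    (hm : ∀ᶠ n in atTop, 0 < m n)
    (hr0 : Tendsto (fun n : ℕ => (n : ℝ) / (m n : ℝ)) atTop (𝓝 r0))
    (hinit : TendstoInDistribution (fun n ω => Real.sqrt (m n) • (βinit n ω - β)) atTop Z
      (fun _ => μ) ν)
    (hlam : ∀ n, 0 ≤ lam n) (heta : ∀ n, 0 ≤ eta n) (hβhat_meas : ∀ n, AEMeasurable (βhat n) μ)
    (hβhat : ∀ n, ∀ᵐ ω ∂μ, βhat n ω ∈ argminSet (transferLassoObjective (X n)
      (linearResponse (X n) β fun i => ε n i ω) (lam n) (eta n) (βinit n ω)))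
    (hlam_sqrt : Tendsto (fun n : ℕ => lam n / Real.sqrt n) atTop atTop)
    (hlam_n : Tendsto (fun n : ℕ => lam n / (n : ℝ)) atTop (𝓝 0))
    {ρ : ℝ} (hρ : Tendsto (fun n : ℕ => eta n / lam n) atTop (𝓝 ρ)) {u₀ : 𝔼 p}
    (hu₀ : argminSet (limitCriterionSlow C β ρ) = {u₀}) :
    TendstoInDistribution (fun (n : ℕ) ω => ((n : ℝ) / lam n) • (βhat n ω - β)) atTop
      (fun _ : Ω' => u₀) (fun _ => μ) ν := by
  have sqrt_div_lam : Tendsto (fun n : ℕ => Real.sqrt n / lam n) atTop (𝓝 0) :=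
    hlam_sqrt.inv_tendsto_atTop.congr fun n => inv_div _ _
  have hT := tendstoInDistribution_smul (tendstoInDistribution_smul hinit hr0.sqrt) sqrt_div_lam
  have hS := tendstoInDistribution_score hC.posSemidef hXC hlaw hindep HasLaw.id
  have hTS := hT.prodMk_of_tendstoInMeasure_const _ _ _ (tendstoInMeasure_smul_zero hS sqrt_div_lam)
    fun n => (hS.forall_aemeasurable n).fun_const_smul _
  rw [limitCriterionSlow_eq_localCriterion] at hu₀
  have lam_pos : ∀ᶠ n in atTop, 0 < lam n :=
    (hlam_sqrt.eventually_gt_atTop 0).mono fun n hn =>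
      (hlam n).lt_of_ne' fun h => hn.ne' (by rw [h, zero_div])
  have n_mul_step : ∀ᶠ n : ℕ in atTop, (n : ℝ) * (lam n / n) = lam n :=
    (eventually_ne_atTop 0).mono fun n hn => mul_div_cancel₀ _ (Nat.cast_ne_zero.2 hn)
  have sqrt_ne_zero : ∀ᶠ n : ℕ in atTop, Real.sqrt n ≠ 0 :=
    (eventually_ne_atTop 0).mono fun n hn => Real.sqrt_ne_zero'.2 (by positivity)
  simpa only [inv_div] using tendstoInDistribution_rescaled_estimator hC hXC hlam heta hβhat_meas
    hβhat (a := fun n => lam n / n) (κ := 1)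
    (by filter_upwards [lam_pos, eventually_gt_atTop 0] with n hn hn0; positivity) hlam_n
    (tendsto_const_nhds.congr' (by
      filter_upwards [lam_pos, n_mul_step] with n hn hstep; rw [hstep, div_self hn.ne']))
    (hρ.congr' (n_mul_step.mono fun n hstep => by simp only [hstep]))
    (by
      filter_upwards [hm] with n hmn ω
      rw [sqrt_div_smul_sqrt_smul hmn, smul_smul, div_mul_eq_mul_div,
        Real.mul_self_sqrt n.cast_nonneg, inv_div])
    (by
      filter_upwards [n_mul_step, sqrt_ne_zero] with n hstep hsqrt ω
      rw [hstep, smul_smul, div_mul_eq_mul_div, mul_inv_cancel₀ hsqrt, one_div])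
    hTS (fun ω => by simpa only [zero_smul] using hu₀)

end TransferLassoAsymptotics

theorem mainTheorem5_general
    {Ω Ω' : Type*} [MeasurableSpace Ω] [MeasurableSpace Ω']
    (μ : Measure Ω) [IsProbabilityMeasure μ] (ν : Measure Ω') [IsProbabilityMeasure ν]
    {p : ℕ} (βstar : 𝔼 p) (σ : ℝ)
    (X : (n : ℕ) → Matrix (Fin n) (Fin p) ℝ) (C : Matrix (Fin p) (Fin p) ℝ)
    (hC : C.PosDef)
    (hXC : Tendsto (fun n : ℕ => (1 / (n : ℝ)) • ((X n)ᵀ * X n)) atTop (𝓝 C))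
    (ε : (n : ℕ) → Fin n → Ω → ℝ)
    (hεlaw : ∀ n i, HasLaw (ε n i) (gaussianReal 0 (Real.toNNReal (σ ^ 2))) μ)
    (hεindep : ∀ n, iIndepFun (ε n) μ)
    (m : ℕ → ℕ) (hm : ∀ᶠ n in atTop, 0 < m n) (r0 : ℝ)
    (hr0 : Tendsto (fun n : ℕ => (n : ℝ) / (m n : ℝ)) atTop (𝓝 r0))
    (βinit : ℕ → Ω → 𝔼 p) (Z : Ω' → 𝔼 p)
    (hinit : TendstoInDistribution
      (fun n ω => Real.sqrt (m n) • (βinit n ω - βstar)) atTop Z (fun _ => μ) ν)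
    (hsource : ∀ n, IndepFun (βinit n) (fun ω i => ε n i ω) μ)
    (lam eta : ℕ → ℝ) (hlam : ∀ n, 0 ≤ lam n) (heta : ∀ n, 0 ≤ eta n)
    (βhat : ℕ → Ω → 𝔼 p) (hβhat_meas : ∀ n, AEMeasurable (βhat n) μ)
    (hβhat : ∀ n, ∀ᵐ ω ∂μ, βhat n ω ∈ argminSet
      (transferLassoObjective (X n) (linearResponse (X n) βstar (fun i => ε n i ω))
        (lam n) (eta n) (βinit n ω))) :
    (∀ rho0 : ℝ, rho0 < 1 →
      Tendsto (fun n : ℕ => eta n / Real.sqrt n) atTop atTop →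
      Tendsto (fun n : ℕ => lam n / eta n) atTop (𝓝 rho0) →
      TendstoInDistribution
        (fun n ω => Real.sqrt (m n) • (βhat n ω - βstar)) atTop Z (fun _ => μ) ν) ∧
    (∀ lam0 eta0 : ℝ, 0 ≤ lam0 → 0 ≤ eta0 →
      Tendsto (fun n : ℕ => lam n / Real.sqrt n) atTop (𝓝 lam0) →
      Tendsto (fun n : ℕ => eta n / Real.sqrt n) atTop (𝓝 eta0) →
      ∀ W : Ω' → 𝔼 p,
        HasLaw W (multivariateGaussian 0 (σ ^ 2 • C)) ν → IndepFun W Z ν →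
        ∃ U : Ω' → 𝔼 p,
          (∀ ω, argminSet (limitCriterionRootN C βstar lam0 eta0 r0 (W ω) (Z ω)) = {U ω}) ∧
          TendstoInDistribution
            (fun (n : ℕ) ω => Real.sqrt n • (βhat n ω - βstar)) atTop U (fun _ => μ) ν) ∧
    (∀ rho0' : ℝ, 0 ≤ rho0' →
      Tendsto (fun n : ℕ => lam n / Real.sqrt n) atTop atTop →
      Tendsto (fun n : ℕ => lam n / (n : ℝ)) atTop (𝓝 0) →
      Tendsto (fun n : ℕ => eta n / lam n) atTop (𝓝 rho0') →
      ∃ u₀ : 𝔼 p,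
        argminSet (limitCriterionSlow C βstar rho0') = {u₀} ∧
        TendstoInDistribution
          (fun (n : ℕ) ω => ((n : ℝ) / lam n) • (βhat n ω - βstar)) atTop
          (fun _ : Ω' => u₀) (fun _ => μ) ν) := by
  have hσ : (Real.toNNReal (σ ^ 2) : ℝ) = σ ^ 2 := Real.coe_toNNReal _ (sq_nonneg σ)
  refine ⟨fun rho0 hrho0 heta_sqrt hratio => ?_,
    fun lam0 eta0 hlam0_nonneg heta0_nonneg hlam0 heta0 W hW hWZ => ?_,
    fun rho0' hrho0' hlam_sqrt hlam_n hratio => ?_⟩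
  · exact tendstoInDistribution_estimator_of_eta_dominant hC.posSemidef hXC hεlaw hεindep hm hr0
      hinit hlam hβhat_meas hβhat hrho0 heta_sqrt hratio
  · choose U hU using fun ω => exists_argminSet_limitCriterionRootN_eq_singleton (β := βstar)
      (r0 := r0) hC hlam0_nonneg heta0_nonneg (W ω) (Z ω)
    rw [← hσ] at hW
    exact ⟨U, hU, tendstoInDistribution_estimator_rootN hC hXC hεlaw hεindep hm hr0 hinit hsource
      hlam heta hβhat_meas hβhat hlam0 heta0 hW hWZ hU⟩
  · obtain ⟨u₀, hu₀⟩ :=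
      exists_argminSet_limitCriterionSlow_eq_singleton (β := βstar) hC hrho0'
    exact ⟨u₀, hu₀, tendstoInDistribution_estimator_slow hC hXC hεlaw hεindep hm hr0 hinit hlam
      heta hβhat_meas hβhat hlam_sqrt hlam_n hratio hu₀⟩

theorem mainTheorem5
    {Ω Ω' : Type*} [MeasurableSpace Ω] [MeasurableSpace Ω']
    (μ : Measure Ω) [IsProbabilityMeasure μ] (ν : Measure Ω') [IsProbabilityMeasure ν]
    {p : ℕ} (βstar : EuclideanSpace ℝ (Fin p)) (σ : ℝ)
    -- design matrices and their limiting Gram matrix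
    (X : (n : ℕ) → Matrix (Fin n) (Fin p) ℝ) (C : Matrix (Fin p) (Fin p) ℝ)
    (hC : C.PosDef)
    (hXC : Tendsto (fun n : ℕ => (1 / (n : ℝ)) • ((X n).transpose * X n)) atTop (𝓝 C))
    (hXmax : Tendsto (fun n : ℕ => (1 / (n : ℝ)) * ⨆ i : Fin n, ∑ j, X n i j ^ 2) atTop (𝓝 0))
    -- i.i.d. Gaussian noise
    (ε : (n : ℕ) → Fin n → Ω → ℝ)
    (hεlaw : ∀ n i, HasLaw (ε n i) (gaussianReal 0 (Real.toNNReal (σ ^ 2))) μ)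
    (hεindep : ∀ n, iIndepFun (ε n) μ)
    -- source sample sizes and the initial estimator
    (m : ℕ → ℕ) (hm : ∀ᶠ n in atTop, 0 < m n) (r0 : ℝ)
    (hr0 : Tendsto (fun n : ℕ => (n : ℝ) / (m n : ℝ)) atTop (𝓝 r0))
    (βinit : ℕ → Ω → EuclideanSpace ℝ (Fin p)) (Z : Ω' → EuclideanSpace ℝ (Fin p))
    (hinit : TendstoInDistribution
      (fun n ω => Real.sqrt (m n) • (βinit n ω - βstar)) atTop Z (fun _ => μ) ν)
    (hsource : ∀ n, IndepFun (βinit n) (fun ω i => ε n i ω) μ)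
    -- regularization parameters and the Transfer Lasso estimator
    (lam eta : ℕ → ℝ) (hlam : ∀ n, 0 ≤ lam n) (heta : ∀ n, 0 ≤ eta n)
    (βhat : ℕ → Ω → EuclideanSpace ℝ (Fin p)) (hβhat_meas : ∀ n, AEMeasurable (βhat n) μ)
    (hβhat : ∀ n, ∀ᵐ ω ∂μ, βhat n ω ∈ argminSet
      (transferLassoObjective (X n) (linearResponse (X n) βstar (fun i => ε n i ω))
        (lam n) (eta n) (βinit n ω))) :
    -- (i)
    (∀ rho0 : ℝ, 0 ≤ rho0 → rho0 < 1 →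
      Tendsto (fun n : ℕ => eta n / Real.sqrt n) atTop atTop →
      Tendsto (fun n : ℕ => lam n / eta n) atTop (𝓝 rho0) →
      TendstoInDistribution
        (fun n ω => Real.sqrt (m n) • (βhat n ω - βstar)) atTop Z (fun _ => μ) ν) ∧
    -- (ii)
    (∀ lam0 eta0 : ℝ, 0 ≤ lam0 → 0 ≤ eta0 →
      Tendsto (fun n : ℕ => lam n / Real.sqrt n) atTop (𝓝 lam0) →
      Tendsto (fun n : ℕ => eta n / Real.sqrt n) atTop (𝓝 eta0) →
      ∀ W : Ω' → EuclideanSpace ℝ (Fin p),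
        HasLaw W (multivariateGaussian 0 (σ ^ 2 • C)) ν → IndepFun W Z ν →
        ∃ U : Ω' → EuclideanSpace ℝ (Fin p),
          (∀ ω, argminSet (limitCriterionRootN C βstar lam0 eta0 r0 (W ω) (Z ω)) = {U ω}) ∧
          TendstoInDistribution
            (fun (n : ℕ) ω => Real.sqrt n • (βhat n ω - βstar)) atTop U (fun _ => μ) ν) ∧
    -- (iii)
    (∀ rho0' : ℝ, 0 ≤ rho0' →
      Tendsto (fun n : ℕ => lam n / Real.sqrt n) atTop atTop →
      Tendsto (fun n : ℕ => lam n / (n : ℝ)) atTop (𝓝 0) →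
      Tendsto (fun n : ℕ => eta n / lam n) atTop (𝓝 rho0') →
      ∃ u₀ : EuclideanSpace ℝ (Fin p),
        argminSet (limitCriterionSlow C βstar rho0') = {u₀} ∧
        TendstoInDistribution
          (fun (n : ℕ) ω => ((n : ℝ) / lam n) • (βhat n ω - βstar)) atTop
          (fun _ : Ω' => u₀) (fun _ => μ) ν) := by
  have h := mainTheorem5_general μ ν βstar σ X C hC hXC ε hεlaw hεindep m hm r0 hr0 βinit Z hinit
    hsource lam eta hlam heta βhat hβhat_meas hβhat
  exact ⟨fun rho0 _ => h.1 rho0, h.2⟩
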